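/- Let $K\subset\mathbb R^2$ be the Sierpiński gasket, i.e. the attractor of $f_i(x)=(x+p_i)/2$, $i=0,1,2$, with $p_0=(0,0)$, $p_1=(1,0)$, $p_2=(\frac12,\frac{\sqrt3}2)$. Let $X$ be the Sierpiński graph. Its vertices are the finite words over $\{0,1,2\}$, its root $o$ is the empty word, and $|w|$ is the length of $w$. Each nonempty word $w=w_1\ldots w_n$ is joined to its father $w^-=w_1\ldots w_{n-1}$ (vertical edges), and two distinct words $w,w'$ of the same length are joined when $f_w(K)\cap f_{w'}(K)\neq\emptyset$ (horizontal edges), where $f_w=f_{w_1}\circ\cdots\circ f_{w_n}$. For a nonempty word put $p_w=f_{w^-}(p_{w_n})$. Let $\lambda\in(0,1)$, $C_1,C_2>0$ and $c_0\in(0,\lambda)$. Define symmetric conductances $c(x,y)$ on $X$ as follows: $c(x,y)=(3\lambda)^{-n}$ if $x$ is the father of $y$ and $|x|=n$; for a horizontal edge with $|x|=|y|=n$, $c(x,y)=C_1(3\lambda)^{-n}$ if $p_x\ne p_y$ and $c(x,y)=C_2(3\lambda)^{-n}$ if $p_x=p_y$; and $c(x,y)=0$ if $x,y$ are not joined. Put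 $\pi(x)=\sum_yc(x,y)$, and let $Z=(Z_n)_{n\ge0}$ be the random walk on $X$ started at $o$ with transition probabilities $P(x,y)=c(x,y)/\pi(x)$. It is transient; let $G(x,y)=\sum_{n\ge0}P^{(n)}(x,y)$ be its Green function, $K(x,y)=G(x,y)/G(o,y)$ its Martin kernel, $\overline X$ its Martin compactification (the smallest compactification of the discrete set $X$ to which all functions $K(x,\cdot)$ extend continuously) and $\partial X=\overline X\setminus X$. Let $m$ be the measure on $\overline X$ with $m(\partial X)=0$ and $m(\{x\})=(c_0/(3\lambda))^{|x|}$ for $x\in X$, and let $$\mathcal E_{\overline X}(u,u)=\tfrac12\sum_{x,y\in X}c(x,y)(u(x)-u(y))^2,\qquad \mathcal F_{\overline X}=\{u\in C(\overline X):\mathcal E_{\overline X}(u,u)<\infty\},$$ $$(\mathcal E_{\overline X})_1(u,u)=\mathcal E_{\overline X}(u,u)+\int_{\overline X}u^2\,dm .$$ Let $\nu$ be the hitting distribution of $Z$, i.e. the law of $Z_\infty=\lim_nZ_n\in\partial X$ (the limit exists almost surely). It is known that $\nu$ is also the image of the normalized $\frac{\log3}{\log2}$-dimensional Hausdorff measure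 on $K$ under the canonical homeomorphism $K\to\partial X$ which sends $\xi$ to the limit in $\overline X$ of the words $w$ with $|w|\to\infty$ and $\mathrm{dist}(\xi,f_w(K))\to0$. The following is asserted for $\nu$ in either description. There is a constant $C>0$, depending only on $\lambda,C_1,C_2,c_0$, such that for all $u\in\mathcal F_{\overline X}$ the function $u$ is square integrable with respect to $\nu$ and $$\left(\int_{\overline X}|u|^2\,d\nu\right)^{1/2}\le C\,\sqrt{(\mathcal E_{\overline X})_1(u,u)} .$$ In particular $\nu$ is of finite energy with respect to $\mathcal E_{\overline X}$: $\int_{\overline X}|u|\,d\nu\le C\sqrt{(\mathcal E_{\overline X})_1(u,u)}$ for all $u\in\mathcal F_{\overline X}$. -/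

import Mathlib

open MeasureTheory Filter Topology Set

noncomputable section

/-! ### Reversible random walks on networks and the Martin compactification -/

section Network

variable {V : Type}

/-- Total conductance `π(x) = ∑_y c(x,y)` at a vertex. -/
def totalConductance (c : V → V → ℝ) (x : V) : ℝ := ∑' y, c x y

/-- Transition probability `P(x,y) = c(x,y) / π(x)`. -/
def transition (c : V → V → ℝ) (x y : V) : ℝ := c x y / totalConductance c x

open Classical in
/-- The `n`-step transition probability `P⁽ⁿ⁾(x,y)`. -/
def nStep (c : V → V → ℝ) : ℕ → V → V → ℝ
  | 0, x, y => if x = y then 1 else 0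
  | n + 1, x, y => ∑' z, transition c x z * nStep c n z y

/-- The Green function `G(x,y) = ∑_n P⁽ⁿ⁾(x,y)`. -/
def green (c : V → V → ℝ) (x y : V) : ℝ := ∑' n, nStep c n x y

/-- The Martin kernel `K(x,y) = G(x,y) / G(o,y)`. -/
def martinKernel (c : V → V → ℝ) (o x y : V) : ℝ := green c x y / green c o y

/-- The evaluation map `y ↦ ((K(x,y))_x, (1_{x}(y))_x)`. The second family of coordinates keeps
the vertices isolated: a compactification of a discrete space is a compactification to which all
indicators of vertices extend continuously. -/
def martinMap (c : V → V → ℝ) (o y : V) : (V → ℝ) × (V → ℝ) :=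
  (fun x => martinKernel c o x y, fun x => indicator {x} (fun _ => (1 : ℝ)) y)

/-- The Martin compactification: the smallest compactification of the discrete vertex set to
which every `K(x,·)` extends continuously, realized as the closure of the image of the vertex set
under the evaluation map. -/
def MartinCompactification (c : V → V → ℝ) (o : V) : Type :=
  closure (range (martinMap c o))

instance (c : V → V → ℝ) (o : V) : TopologicalSpace (MartinCompactification c o) :=
  inferInstanceAs (TopologicalSpace (closure (range (martinMap c o))))

instance (c : V → V → ℝ) (o : V) : MeasurableSpace (MartinCompactification c o) :=
  borel _

instance (c : V → V → ℝ) (o : V) : BorelSpace (MartinCompactification c o) :=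
  ⟨rfl⟩

/-- The inclusion of the vertex set in its Martin compactification. -/
def toMartin (c : V → V → ℝ) (o y : V) : MartinCompactification c o :=
  ⟨martinMap c o y, subset_closure (mem_range_self y)⟩

open Classical in
/-- The limit in the Martin compactification of vertices `g a` as `a` runs through the filter `l`;
by convention the root if there is no limit. -/
def martinLimit {A : Type*} (c : V → V → ℝ) (o : V) (l : Filter A) (g : A → V) :
    MartinCompactification c o :=
  if h : ∃ z, Tendsto (fun a => toMartin c o (g a)) l (𝓝 z) then h.choose else toMartin c o o

/-- `Z` is a random walk (time-homogeneous Markov chain on the countable set `V`) with transition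
probability `P(x,y) = c(x,y) / π(x)`, started at `o`, on the probability space `(Ω, ℙ)`. -/
structure IsRandomWalk {Ω : Type*} [MeasurableSpace Ω] (c : V → V → ℝ) (o : V)
    (ℙ : Measure Ω) (Z : ℕ → Ω → V) : Prop where
  measurable : ∀ n x, MeasurableSet (Z n ⁻¹' {x})
  start : ∀ᵐ ω ∂ℙ, Z 0 ω = o
  markov : ∀ (n : ℕ) (x : ℕ → V),
    ℙ {ω | ∀ k ≤ n + 1, Z k ω = x k} =
      ℙ {ω | ∀ k ≤ n, Z k ω = x k} * ENNReal.ofReal (transition c (x n) (x (n + 1)))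

/-- The hitting distribution: the law of `Z_∞ = lim Z_n` in the Martin compactification. For a
transient walk the limit exists and lies in the Martin boundary almost surely. -/
def hittingDistribution {Ω : Type*} [MeasurableSpace Ω] (c : V → V → ℝ) (o : V)
    (ℙ : Measure Ω) (Z : ℕ → Ω → V) : Measure (MartinCompactification c o) :=
  ℙ.map (fun ω => martinLimit c o atTop (fun n => Z n ω))

/-- The domain of the form on the Martin compactification: continuous functions of finite
energy. -/
def formDomain (c : V → V → ℝ) (o : V) : Set C(MartinCompactification c o, ℝ) :=
  {u | Summable fun p : V × V =>
    c p.1 p.2 * (u (toMartin c o p.1) - u (toMartin c o p.2)) ^ 2}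

/-- The energy `½ ∑_{x,y} c(x,y) (u(x) - u(y))²`. -/
def formEnergy (c : V → V → ℝ) (o : V) (u : C(MartinCompactification c o, ℝ)) : ℝ :=
  (1 / 2) * ∑' p : V × V, c p.1 p.2 * (u (toMartin c o p.1) - u (toMartin c o p.2)) ^ 2

/-- A positive weight on the vertices, as a measure on the Martin compactification giving no mass
to the boundary. -/
def vertexMeasure (c : V → V → ℝ) (o : V) (m : V → ℝ) :
    Measure (MartinCompactification c o) :=
  Measure.sum fun x => ENNReal.ofReal (m x) • Measure.dirac (toMartin c o x)

/-- `ℰ₁(u,u) = ℰ(u,u) + ∫ u² dm`. -/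
def formEnergyOne (c : V → V → ℝ) (o : V) (m : V → ℝ)
    (u : C(MartinCompactification c o, ℝ)) : ℝ :=
  formEnergy c o u + ∫ z, u z ^ 2 ∂(vertexMeasure c o m)

end Network

/-! ### The Sierpinski gasket and the Sierpinski graph -/

/-- The Euclidean plane. -/
abbrev Plane : Type := EuclideanSpace ℝ (Fin 2)

/-- Finite words over `{0,1,2}`, the vertices of the Sierpinski graph. The root is the empty word,
and the father of a nonempty word is obtained by dropping its last letter. -/
abbrev Word : Type := List (Fin 3)

/-- The corners `p₀ = (0,0)`, `p₁ = (1,0)`, `p₂ = (1/2, √3/2)` of the gasket. -/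
def sgCorner : Fin 3 → Plane :=
  ![!₂[0, 0], !₂[1, 0], !₂[1 / 2, √3 / 2]]

/-- The contractions `f_i(x) = (x + p_i)/2`. -/
def sgMap (i : Fin 3) (x : Plane) : Plane := (1 / 2 : ℝ) • (x + sgCorner i)

/-- The sets `V_{n+1}`: `V₁ = {p₀, p₁, p₂}` and `V_{n+1} = ⋃ i, f_i(V_n)`. -/
def sgVertices : ℕ → Set Plane
  | 0 => range sgCorner
  | n + 1 => ⋃ i, sgMap i '' sgVertices n

/-- The Sierpinski gasket `K`, the closure of `⋃ n, V_n`. -/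
def gasket : Set Plane := closure (⋃ n, sgVertices n)

/-- `f_w = f_{w₁} ∘ ⋯ ∘ f_{wₙ}`. -/
def wordMap : Word → Plane → Plane
  | [], x => x
  | i :: w, x => sgMap i (wordMap w x)

/-- The cell `K_w = f_w(K)`. -/
def sgCell (w : Word) : Set Plane := wordMap w '' gasket

/-- The point `p_w = f_{w₁⋯wₙ₋₁}(p_{wₙ})` (used for nonempty words only). -/
def wordPoint (w : Word) : Plane := wordMap w.dropLast (sgCorner (w.getLastD 0))

/-- `x` is the father of `y`. -/
def IsFather (x y : Word) : Prop := y ≠ [] ∧ y.dropLast = x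

/-- Horizontal edges: distinct words of the same length whose cells meet. -/
def IsHorizontalEdge (x y : Word) : Prop :=
  x.length = y.length ∧ x ≠ y ∧ (sgCell x ∩ sgCell y).Nonempty

open Classical in
/-- The conductance of the `lam`-return ratio random walk on the Sierpinski graph:
`(3 lam)⁻ⁿ` on the vertical edges between levels `n` and `n + 1`, and, on the horizontal edges of
level `n`, `C₁ (3 lam)⁻ⁿ` for type I (`p_x ≠ p_y`) and `C₂ (3 lam)⁻ⁿ` for type II (`p_x = p_y`). -/
def sgConductance (lam C₁ C₂ : ℝ) (x y : Word) : ℝ :=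
  if IsFather x y then 1 / (3 * lam) ^ x.length
  else if IsFather y x then 1 / (3 * lam) ^ y.length
  else if IsHorizontalEdge x y then
    if wordPoint x ≠ wordPoint y then C₁ / (3 * lam) ^ x.length
    else C₂ / (3 * lam) ^ x.length
  else 0

/-- The weight `m(x) = (c / (3 lam))^{|x|}`. -/
def sgWeight (lam c : ℝ) (x : Word) : ℝ := (c / (3 * lam)) ^ x.length

/-- Words approaching a point `ξ` of the gasket: the length tends to infinity and the cell tends
to `ξ`. -/
def approach (ξ : Plane) : Filter Word :=
  comap List.length atTop ⊓ comap (fun w => Metric.infDist ξ (sgCell w)) (𝓝 0)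

/-- The canonical identification of the gasket with the Martin boundary, sending `ξ` to the limit
in the Martin compactification of the words approaching `ξ`. -/
def gasketToMartin (c : Word → Word → ℝ) (ξ : Plane) : MartinCompactification c [] :=
  martinLimit c [] (approach ξ) id

/-- The normalized Hausdorff measure (of dimension `log 3 / log 2`) on the gasket, carried to the
Martin boundary by the canonical identification. -/
def gasketMeasure (c : Word → Word → ℝ) : Measure (MartinCompactification c []) :=
  (ProbabilityTheory.cond (Measure.hausdorffMeasure (Real.log 3 / Real.log 2)) gasket).map
    (gasketToMartin c)

end

/-! Only vertical edges and the root are needed. Let `M n` be the mean of `u²` over the `3 ^ n`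
words of length `n`, and `V n` the energy between levels `n` and `n + 1`. Since the conductance
there is `(3 lam)⁻ⁿ`, passing from one level to the next changes `u` in mean square by `lam ^ n * V
n / 3`. Cauchy–Schwarz with the summable weights `lam ^ n` then bounds every `M n` by a multiple of
`u(o)² + ∑ V k` (`levelMeanSq_le`), hence of `ℰ₁(u,u)`, because `m` has mass `1` at the root.

It remains to bound `∫ u² dν` by Fatou's lemma along the levels. For the Hausdorff description, a
cell of level `n` has mass at most `3⁻ⁿ`, so the sum of `u(w)²` over the level-`n` cells containing
`ξ` has integral at most `M n` (`lintegral_cellSum_le`). For the hitting description, `lam ^ |x|` is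
superharmonic and controls the Green function, so the walk crosses an edge from `w` to a child at
most `3⁻ⁿ / (3 (1 - lam))` times on average (`lintegral_upcrossingSum_le`); almost surely it makes
such a crossing from every level.

The two descriptions are bounded separately, so their agreement is not needed. Existence of the
limits is not needed either: `martinLimit` falls back to the root, whose value `u(o)²` is added to
the bound. -/

/-! ### Words of a given length -/

/-- The words of length `n`. -/
def levelWords : ℕ → Finset Word
  | 0 => {[]}
  | n + 1 => (levelWords n ×ˢ Finset.univ).image fun p => p.1 ++ [p.2]

theorem mem_levelWords {n : ℕ} {w : Word} : w ∈ levelWords n ↔ w.length = n := by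
  induction n generalizing w with
  | zero => simp [levelWords]
  | succ n ih =>
    simp only [levelWords, Finset.mem_image, Finset.mem_product, Finset.mem_univ, and_true,
      Prod.exists, ih]
    constructor
    · rintro ⟨v, i, hv, rfl⟩
      simp [hv]
    · intro hw
      have hne : w ≠ [] := by rintro rfl; simp at hw
      exact ⟨w.dropLast, w.getLast hne, by simp [hw], List.dropLast_append_getLast hne⟩

theorem sum_levelWords_succ {M : Type*} [AddCommMonoid M] (n : ℕ) (F : Word → M) :
    ∑ w ∈ levelWords (n + 1), F w = ∑ w ∈ levelWords n, ∑ i, F (w ++ [i]) := by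
  rw [levelWords, Finset.sum_image, Finset.sum_product]
  rintro ⟨v, i⟩ - ⟨v', i'⟩ - h
  simpa using h

theorem tsum_eq_tsum_levelWords (F : Word → ENNReal) :
    ∑' w, F w = ∑' n, ∑ w ∈ levelWords n, F w := by
  classical
  have h (n : ℕ) : ∑ w ∈ levelWords n, F w = ∑' w : Word, if n = w.length then F w else 0 := by
    rw [tsum_eq_sum (s := levelWords n)]
    · exact Finset.sum_congr rfl fun w hw => by rw [if_pos (mem_levelWords.1 hw).symm]
    · intro w hw
      exact if_neg fun h => hw (mem_levelWords.2 h.symm)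
  simp_rw [h]
  rw [ENNReal.tsum_comm]
  simp

/-! ### Mean squares along the levels -/

/-- The mean of `f²` over the words of length `n`. -/
noncomputable def levelMeanSq (f : Word → ℝ) (n : ℕ) : ℝ := (∑ w ∈ levelWords n, f w ^ 2) / 3 ^ n

/-- The energy of `f` on the edges between the levels `n` and `n + 1`, each edge counted once. -/
noncomputable def verticalEnergy (lam : ℝ) (f : Word → ℝ) (n : ℕ) : ℝ :=
  (∑ w ∈ levelWords n, ∑ i, (f (w ++ [i]) - f w) ^ 2) / (3 * lam) ^ n

theorem verticalEnergy_nonneg {lam : ℝ} (h0 : 0 < lam) (f : Word → ℝ) (n : ℕ) :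
    0 ≤ verticalEnergy lam f n := by
  unfold verticalEnergy
  exact div_nonneg (Finset.sum_nonneg fun _ _ => Finset.sum_nonneg fun _ _ => sq_nonneg _)
    (by positivity)

theorem add_sq_le_mul_div_add_div {S t : ℝ} (hS : 0 < S) (ht : 0 < t) (a b : ℝ) :
    (a + b) ^ 2 ≤ (S + t) * (a ^ 2 / S + b ^ 2 / t) := by
  rw [div_add_div _ _ hS.ne' ht.ne', mul_div_assoc', le_div_iff₀ (by positivity)]
  nlinarith [sq_nonneg (a * t - b * S)]

/-- Weighted Cauchy–Schwarz on `f (w ++ [i]) = f w + (f (w ++ [i]) - f w)`, with weight `lam ^ n` on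
the increment to match the conductance. A factor `1/3` in front of the energy is discarded. -/
theorem levelMeanSq_succ_le {lam S : ℝ} (h0 : 0 < lam) (hS : 0 < S) (f : Word → ℝ) (n : ℕ) :
    levelMeanSq f (n + 1) ≤
      (S + lam ^ n) * (levelMeanSq f n / S + verticalEnergy lam f n) := by
  have ht : 0 < lam ^ n := by positivity
  have key : ∑ w ∈ levelWords (n + 1), f w ^ 2 ≤ (S + lam ^ n) *
      (3 * (∑ w ∈ levelWords n, f w ^ 2) / S +
        (∑ w ∈ levelWords n, ∑ i, (f (w ++ [i]) - f w) ^ 2) / lam ^ n) := by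
    calc ∑ w ∈ levelWords (n + 1), f w ^ 2
        ≤ ∑ w ∈ levelWords n, ∑ i : Fin 3, (S + lam ^ n) *
            (f w ^ 2 / S + (f (w ++ [i]) - f w) ^ 2 / lam ^ n) := by
          rw [sum_levelWords_succ]
          refine Finset.sum_le_sum fun w _ => Finset.sum_le_sum fun i _ => ?_
          simpa using add_sq_le_mul_div_add_div hS ht (f w) (f (w ++ [i]) - f w)
      _ = _ := by
          simp_rw [← Finset.mul_sum, Finset.sum_add_distrib, ← Finset.sum_div]
          simp [Finset.mul_sum]
  have hV : verticalEnergy lam f n * 3 ^ n =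
      (∑ w ∈ levelWords n, ∑ i, (f (w ++ [i]) - f w) ^ 2) / lam ^ n := by
    unfold verticalEnergy
    rw [mul_pow]
    field_simp
  have hM : levelMeanSq f n * 3 ^ n = ∑ w ∈ levelWords n, f w ^ 2 := by
    unfold levelMeanSq
    field_simp
  have hV0 := verticalEnergy_nonneg h0 f n
  rw [← hV, ← hM] at key
  rw [levelMeanSq, div_le_iff₀ (by positivity)]
  refine key.trans ?_
  rw [mul_assoc]
  refine mul_le_mul_of_nonneg_left ?_ (by positivity)
  have h3 : (0 : ℝ) < 3 ^ n := by positivity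
  have : levelMeanSq f n / S * 3 ^ (n + 1) = 3 * (levelMeanSq f n * 3 ^ n) / S := by ring
  rw [add_mul, this, pow_succ]
  nlinarith [mul_nonneg hV0 h3.le]

theorem levelMeanSq_le_sum {lam : ℝ} (h0 : 0 < lam) (f : Word → ℝ) (n : ℕ) :
    levelMeanSq f n ≤ (1 + ∑ k ∈ Finset.range n, lam ^ k) *
      (f [] ^ 2 + ∑ k ∈ Finset.range n, verticalEnergy lam f k) := by
  induction n with
  | zero => simp [levelMeanSq, levelWords]
  | succ n ih =>
    -- With `S` the partial sum of the weights, the two factors of the one-step bound become exactly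
    -- the next partial sums.
    have hS : 0 < 1 + ∑ k ∈ Finset.range n, lam ^ k := by positivity
    rw [Finset.sum_range_succ, Finset.sum_range_succ, ← add_assoc, ← add_assoc]
    refine (levelMeanSq_succ_le h0 hS f n).trans ?_
    gcongr
    rwa [div_le_iff₀' hS]

theorem levelMeanSq_le {lam E : ℝ} (h0 : 0 < lam) (h1 : lam < 1) {f : Word → ℝ}
    (hE : ∀ n, ∑ k ∈ Finset.range n, verticalEnergy lam f k ≤ E) (n : ℕ) :
    levelMeanSq f n ≤ (1 + (1 - lam)⁻¹) * (f [] ^ 2 + E) := by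
  have hgeom : ∑ k ∈ Finset.range n, lam ^ k ≤ (1 - lam)⁻¹ := by
    rw [← tsum_geometric_of_lt_one h0.le h1]
    exact (summable_geometric_of_lt_one h0.le h1).sum_le_tsum _ fun k _ => by positivity
  have := sub_pos.2 h1
  refine (levelMeanSq_le_sum h0 f n).trans (mul_le_mul (by gcongr) (by gcongr; exact hE n) ?_ ?_)
  · exact add_nonneg (sq_nonneg _) (Finset.sum_nonneg fun k _ => verticalEnergy_nonneg h0 f k)
  · positivity

/-! ### Conductances -/

theorem isFather_append (w : Word) (i : Fin 3) : IsFather w (w ++ [i]) := by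
  simp [IsFather]

theorem isFather_iff {x y : Word} : IsFather x y ↔ ∃ i, y = x ++ [i] := by
  constructor
  · rintro ⟨hy, rfl⟩
    exact ⟨y.getLast hy, (List.dropLast_append_getLast hy).symm⟩
  · rintro ⟨i, rfl⟩
    exact isFather_append x i

theorem IsFather.length_eq {x y : Word} (h : IsFather x y) : y.length = x.length + 1 := by
  obtain ⟨i, rfl⟩ := isFather_iff.1 h
  simp

section Conductance

variable {lam C₁ C₂ : ℝ}

theorem sgConductance_append (w : Word) (i : Fin 3) :
    sgConductance lam C₁ C₂ w (w ++ [i]) = 1 / (3 * lam) ^ w.length := by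
  rw [sgConductance, if_pos (isFather_append w i)]

theorem isHorizontalEdge_comm {x y : Word} : IsHorizontalEdge x y ↔ IsHorizontalEdge y x := by
  unfold IsHorizontalEdge
  rw [eq_comm, ne_comm, inter_comm]

theorem sgConductance_comm (x y : Word) :
    sgConductance lam C₁ C₂ x y = sgConductance lam C₁ C₂ y x := by
  unfold sgConductance
  by_cases hxy : IsFather x y
  · have hyx : ¬ IsFather y x := fun h => by have := h.length_eq; have := hxy.length_eq; omega
    simp [hxy, hyx]
  by_cases hyx : IsFather y x
  · simp [hxy, hyx]
  by_cases hh : IsHorizontalEdge x y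
  · simp [hxy, hyx, hh, isHorizontalEdge_comm.1 hh, hh.1, eq_comm]
  · simp [hxy, hyx, hh, mt isHorizontalEdge_comm.2 hh]

theorem sgConductance_nonneg (h0 : 0 < lam) (hC₁ : 0 < C₁) (hC₂ : 0 < C₂) (x y : Word) :
    0 ≤ sgConductance lam C₁ C₂ x y := by
  unfold sgConductance
  split_ifs <;> positivity

theorem isFather_or_of_sgConductance_ne_zero {x y : Word} (h : sgConductance lam C₁ C₂ x y ≠ 0) :
    IsFather x y ∨ IsFather y x ∨ x.length = y.length := by
  by_contra! hn
  refine h ?_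
  rw [sgConductance, if_neg hn.1, if_neg hn.2.1, if_neg fun h' => hn.2.2 h'.1]

/-- The total conductance of the horizontal edges at a vertex. -/
noncomputable def horizontalConductance (lam C₁ C₂ : ℝ) (y : Word) : ℝ :=
  ∑ x ∈ levelWords y.length, sgConductance lam C₁ C₂ y x

/-- For a function of the length alone, horizontal edges only contribute the value at the vertex
itself. Their total conductance can stay unevaluated, since it cancels against the same term in `π`.
-/
theorem hasSum_mul_sgConductance_nil (G : ℕ → ℝ) :
    HasSum (fun x : Word => G x.length * sgConductance lam C₁ C₂ [] x)
      (G 0 * horizontalConductance lam C₁ C₂ [] + 3 * G 1) := by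
  have h : HasSum (fun x : Word => G x.length * sgConductance lam C₁ C₂ [] x) _ :=
    hasSum_sum_of_ne_finset_zero (s := levelWords 0 ∪ levelWords 1) (by
      intro x hx
      simp only [Finset.mem_union, mem_levelWords, not_or] at hx
      by_contra hne
      rcases isFather_or_of_sgConductance_ne_zero (right_ne_zero_of_mul hne) with h | h | h
      · have := h.length_eq; simp at this; omega
      · have := h.length_eq; simp at this
      · simp at h; exact hx.1 (by simp [← h]))
  rw [Finset.sum_union (by
    rw [Finset.disjoint_left]; intro x; simp only [mem_levelWords]; omega),
    sum_levelWords_succ] at h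
  convert h using 2
  · simp [levelWords, horizontalConductance]
  · simp only [levelWords, Finset.sum_singleton, sgConductance_append]
    simp

theorem hasSum_mul_sgConductance_append (G : ℕ → ℝ) (v : Word) (j : Fin 3) :
    HasSum (fun x : Word => G x.length * sgConductance lam C₁ C₂ (v ++ [j]) x)
      (G v.length / (3 * lam) ^ v.length
        + G (v.length + 1) * horizontalConductance lam C₁ C₂ (v ++ [j])
        + 3 * G (v.length + 2) / (3 * lam) ^ (v.length + 1)) := by
  classical
  set y := v ++ [j] with hy
  have hl : y.length = v.length + 1 := by simp [hy]
  have hch : Function.Injective fun i : Fin 3 => y ++ [i] := fun i i' h => by simpa using h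
  have h : HasSum (fun x : Word => G x.length * sgConductance lam C₁ C₂ y x) _ :=
    hasSum_sum_of_ne_finset_zero
    (s := ({v} ∪ levelWords y.length) ∪ Finset.univ.image fun i : Fin 3 => y ++ [i]) (by
      intro x hx
      simp only [Finset.mem_union, mem_levelWords, not_or, Finset.mem_singleton,
        Finset.mem_image, Finset.mem_univ, true_and] at hx
      by_contra hne
      rcases isFather_or_of_sgConductance_ne_zero (right_ne_zero_of_mul hne) with h | h | h
      · obtain ⟨i, rfl⟩ := isFather_iff.1 h
        exact hx.2 ⟨i, rfl⟩
      · obtain ⟨i, hi⟩ := isFather_iff.1 h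
        rw [hy] at hi
        exact hx.1.1 (List.append_inj_left' hi rfl).symm
      · exact hx.1.2 h.symm)
  rw [Finset.sum_union (by
    rw [Finset.disjoint_left]
    simp only [Finset.mem_union, Finset.mem_singleton, mem_levelWords, Finset.mem_image,
      Finset.mem_univ, true_and]
    rintro x hx ⟨i, rfl⟩
    rcases hx with hx | hx
    · have := congrArg List.length hx; simp [hl] at this; omega
    · simp at hx), Finset.sum_union (by
    rw [Finset.disjoint_singleton_left, mem_levelWords]; omega),
    Finset.sum_image hch.injOn, Finset.sum_singleton] at h
  convert h using 2
  · congr 1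
    · rw [sgConductance_comm, hy, sgConductance_append]; ring
    · rw [horizontalConductance, Finset.mul_sum]
      refine Finset.sum_congr rfl fun x hx => ?_
      rw [mem_levelWords.1 hx, hl]
  · simp only [sgConductance_append, List.length_append, hl, List.length_singleton]
    simp; ring

theorem summable_sgConductance (y : Word) : Summable (sgConductance lam C₁ C₂ y) := by
  rcases List.eq_nil_or_concat y with rfl | ⟨v, j, rfl⟩
  · simpa using (hasSum_mul_sgConductance_nil (lam := lam) (C₁ := C₁) (C₂ := C₂) 1).summable
  · simpa using
      (hasSum_mul_sgConductance_append (lam := lam) (C₁ := C₁) (C₂ := C₂) 1 v j).summable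

theorem totalConductance_pos (h0 : 0 < lam) (hC₁ : 0 < C₁) (hC₂ : 0 < C₂) (y : Word) :
    0 < totalConductance (sgConductance lam C₁ C₂) y := by
  refine (summable_sgConductance y).tsum_pos (sgConductance_nonneg h0 hC₁ hC₂ y) (y ++ [0]) ?_
  rw [sgConductance_append]
  positivity

/-- The function `λ^{|x|}` is superharmonic: harmonic off the root, with charge `3 (1 - λ)` at the
root. -/
theorem hasSum_pow_length_mul_sgConductance (h0 : 0 < lam) (y : Word) :
    HasSum (fun x : Word => lam ^ x.length * sgConductance lam C₁ C₂ y x)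
      (lam ^ y.length * totalConductance (sgConductance lam C₁ C₂) y
        - if y = [] then 3 * (1 - lam) else 0) := by
  rcases List.eq_nil_or_concat y with rfl | ⟨v, j, rfl⟩
  · have h := hasSum_mul_sgConductance_nil (lam := lam) (C₁ := C₁) (C₂ := C₂) 1
    have hG := hasSum_mul_sgConductance_nil (lam := lam) (C₁ := C₁) (C₂ := C₂) (lam ^ ·)
    simp only [Pi.one_apply, one_mul] at h
    convert hG using 1
    rw [totalConductance]
    erw [h.tsum_eq]
    simp; ring
  · rw [List.concat_eq_append]
    have h := hasSum_mul_sgConductance_append (lam := lam) (C₁ := C₁) (C₂ := C₂) 1 v j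
    have hG := hasSum_mul_sgConductance_append (lam := lam) (C₁ := C₁) (C₂ := C₂) (lam ^ ·) v j
    simp only [Pi.one_apply, one_mul] at h
    -- Harmonicity at level `n + 1` is the balance of the flux `3⁻ⁿ (1 - lam)` from the father with
    -- the equal flux to the three children.
    convert hG using 1
    rw [totalConductance, h.tsum_eq]
    simp only [List.length_append, List.length_singleton, List.append_eq_nil_iff,
      List.cons_ne_self, and_false, if_false, pow_succ, mul_pow]
    field_simp
    ring

end Conductance

/-! ### Random walks -/

/-- The sum of `f²` over the up-crossings of `z` from level `L` to level `L + 1`. -/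
noncomputable def upcrossingSum {Ω : Type*} (f : Word → ℝ) (Z : ℕ → Ω → Word) (L : ℕ)
    (ω : Ω) : ENNReal :=
  ∑ w ∈ levelWords L, ∑ i, ∑' n,
    (Z n ⁻¹' {w} ∩ Z (n + 1) ⁻¹' {w ++ [i]}).indicator (fun _ => ENNReal.ofReal (f w ^ 2)) ω

theorem le_upcrossingSum {Ω : Type*} {Z : ℕ → Ω → Word} (f : Word → ℝ) {ω : Ω} {n L : ℕ}
    (hL : (Z n ω).length = L) {i : Fin 3} (hi : Z (n + 1) ω = Z n ω ++ [i]) :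
    ENNReal.ofReal (f (Z n ω) ^ 2) ≤ upcrossingSum f Z L ω := by
  refine le_trans ?_ (Finset.single_le_sum (fun _ _ => zero_le) (mem_levelWords.2 hL))
  refine le_trans ?_ (Finset.single_le_sum (fun _ _ => zero_le) (Finset.mem_univ i))
  refine le_trans ?_ (ENNReal.le_tsum n)
  exact (indicator_of_mem (s := Z n ⁻¹' {Z n ω} ∩ Z (n + 1) ⁻¹' {Z n ω ++ [i]}) ⟨rfl, hi⟩
    fun _ => ENNReal.ofReal (f (Z n ω) ^ 2)).ge

section RandomWalk

variable {Ω : Type*} [MeasurableSpace Ω] {ℙ : Measure Ω}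

/-- The Markov property is given only for full histories; sum it over the countably many histories
before time `n`. -/
theorem IsRandomWalk.measure_step {V : Type} [Countable V] {c : V → V → ℝ} {o : V}
    {Z : ℕ → Ω → V} (h : IsRandomWalk c o ℙ Z) (n : ℕ) (x y : V) :
    ℙ (Z n ⁻¹' {x} ∩ Z (n + 1) ⁻¹' {y}) =
      ℙ (Z n ⁻¹' {x}) * ENNReal.ofReal (transition c x y) := by
  -- A history `v` before time `n`, continued by `x` at time `n` and by `y` from then on.
  let path : (Fin n → V) → ℕ → V := fun v k =>
    if hk : k < n then v ⟨k, hk⟩ else if k = n then x else y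
  have path_lt (v k) (hk : k < n) : path v k = v ⟨k, hk⟩ := dif_pos hk
  have path_n (v) : path v n = x := by simp [path]
  have path_succ (v) : path v (n + 1) = y := by simp [path]
  clear_value path
  have hmeas (m : ℕ) (v : Fin n → V) : MeasurableSet {ω | ∀ k ≤ m, Z k ω = path v k} := by
    simp only [ofPred_forall]
    exact MeasurableSet.iInter fun k => MeasurableSet.iInter fun _ => h.measurable k _
  have hdisj (m : ℕ) (hm : n ≤ m) :
      Pairwise (Function.onFun Disjoint fun v => {ω | ∀ k ≤ m, Z k ω = path v k}) := by
    intro v v' hv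
    refine Set.disjoint_left.2 fun ω hω hω' => hv (funext fun k => ?_)
    have hk : k.1 ≤ m := k.2.le.trans hm
    rw [← path_lt v k k.2, ← path_lt v' k k.2, ← hω k hk, ← hω' k hk]
  have hA : Z n ⁻¹' {x} = ⋃ v, {ω | ∀ k ≤ n, Z k ω = path v k} := by
    ext ω
    simp only [mem_preimage, mem_singleton_iff, mem_iUnion, mem_ofPred_eq]
    constructor
    · intro hx
      refine ⟨fun k : Fin n => Z k ω, fun k hk => ?_⟩
      rcases hk.lt_or_eq with hk | rfl
      · exact (path_lt (fun k : Fin n => Z k ω) k hk).symm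
      · exact hx.trans (path_n _).symm
    · rintro ⟨v, hv⟩
      rw [hv n le_rfl, path_n]
  have hB : Z n ⁻¹' {x} ∩ Z (n + 1) ⁻¹' {y} = ⋃ v, {ω | ∀ k ≤ n + 1, Z k ω = path v k} := by
    ext ω
    simp only [mem_inter_iff, mem_preimage, mem_singleton_iff, mem_iUnion, mem_ofPred_eq]
    constructor
    · rintro ⟨hx, hy⟩
      refine ⟨fun k : Fin n => Z k ω, fun k hk => ?_⟩
      rcases hk.lt_or_eq with hk | rfl
      · rcases (Nat.lt_succ_iff.1 hk).lt_or_eq with hk | rfl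
        · exact (path_lt (fun k : Fin n => Z k ω) k hk).symm
        · exact hx.trans (path_n _).symm
      · exact hy.trans (path_succ _).symm
    · rintro ⟨v, hv⟩
      rw [hv n n.le_succ, path_n, hv (n + 1) le_rfl, path_succ]
      exact ⟨rfl, rfl⟩
  rw [hB, hA, measure_iUnion (hdisj _ n.le_succ) (hmeas _), measure_iUnion (hdisj _ le_rfl)
    (hmeas _), ← ENNReal.tsum_mul_right]
  refine tsum_congr fun v => ?_
  rw [h.markov, path_n, path_succ]

theorem IsRandomWalk.measure_succ {V : Type} [Countable V] {c : V → V → ℝ} {o : V}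
    {Z : ℕ → Ω → V} (h : IsRandomWalk c o ℙ Z) (n : ℕ) (y : V) :
    ℙ (Z (n + 1) ⁻¹' {y}) =
      ∑' x, ℙ (Z n ⁻¹' {x}) * ENNReal.ofReal (transition c x y) := by
  simp_rw [← h.measure_step]
  rw [← measure_iUnion _ fun x => (h.measurable _ _).inter (h.measurable _ _)]
  · congr 1
    ext ω
    simp
  · intro x x' hx
    refine Set.disjoint_left.2 fun ω hω hω' => hx ?_
    exact hω.1.symm.trans hω'.1

theorem IsRandomWalk.ae_conductance_ne_zero {V : Type} [Countable V] {c : V → V → ℝ} {o : V}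
    {Z : ℕ → Ω → V} (h : IsRandomWalk c o ℙ Z) :
    ∀ᵐ ω ∂ℙ, ∀ n, c (Z n ω) (Z (n + 1) ω) ≠ 0 := by
  have key : ∀ᵐ ω ∂ℙ, ∀ n x y, c x y = 0 → ω ∉ Z n ⁻¹' {x} ∩ Z (n + 1) ⁻¹' {y} := by
    simp only [ae_all_iff]
    intro n x y hc
    refine measure_eq_zero_iff_ae_notMem.1 ?_
    rw [h.measure_step, transition, hc]
    simp
  filter_upwards [key] with ω hω n hn
  exact hω n _ _ hn ⟨rfl, rfl⟩

variable {lam C₁ C₂ : ℝ} {Z : ℕ → Ω → Word}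

/-- The expected number of visits to a vertex is at most `λ^{|y|} π(y) / (3 (1 - λ))`. -/
theorem tsum_measure_visit_le [IsProbabilityMeasure ℙ] (h0 : 0 < lam) (h1 : lam < 1)
    (hC₁ : 0 < C₁) (hC₂ : 0 < C₂) (h : IsRandomWalk (sgConductance lam C₁ C₂) [] ℙ Z)
    (y : Word) :
    ∑' n, ℙ (Z n ⁻¹' {y}) ≤ ENNReal.ofReal
      (lam ^ y.length * totalConductance (sgConductance lam C₁ C₂) y / (3 * (1 - lam))) := by
  have hK : 0 < 3 * (1 - lam) := by linarith
  have hπ := totalConductance_pos h0 hC₁ hC₂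
  refine ENNReal.tsum_le_of_sum_range_le fun N => ?_
  -- The truncated Green functions satisfy `G_{N+1} = δ_o + G_N P`, and the bound `g` satisfies `g =
  -- δ_o + g P`; so `G_N ≤ g` passes from `N` to `N + 1`.
  induction N generalizing y with
  | zero => simp
  | succ N ih =>
    have hsum := (hasSum_pow_length_mul_sgConductance (C₁ := C₁) (C₂ := C₂) h0 y).div_const
      (3 * (1 - lam))
    have hnn (x : Word) : 0 ≤ lam ^ x.length * sgConductance lam C₁ C₂ y x / (3 * (1 - lam)) := by
      have := sgConductance_nonneg h0 hC₁ hC₂ y x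
      positivity
    have hstep : ∑ n ∈ Finset.range N, ℙ (Z (n + 1) ⁻¹' {y}) ≤ ENNReal.ofReal
        ((lam ^ y.length * totalConductance (sgConductance lam C₁ C₂) y -
          if y = [] then 3 * (1 - lam) else 0) / (3 * (1 - lam))) := by
      rw [← hsum.tsum_eq, ENNReal.ofReal_tsum_of_nonneg hnn hsum.summable]
      simp_rw [h.measure_succ]
      rw [← Summable.tsum_finsetSum fun _ _ => ENNReal.summable]
      refine ENNReal.tsum_le_tsum fun x => ?_
      rw [← Finset.sum_mul]
      refine (mul_le_mul_left (ih x) _).trans_eq ?_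
      -- Reversibility: the factor `π(x)` in the bound cancels the denominator of `P(x,y)`.
      rw [← ENNReal.ofReal_mul (by have := hπ x; positivity), transition, sgConductance_comm y x]
      congr 1
      have := (hπ x).ne'
      field_simp
    have hstart : ℙ (Z 0 ⁻¹' {y}) ≤ ENNReal.ofReal
        ((if y = [] then 3 * (1 - lam) else 0) / (3 * (1 - lam))) := by
      split_ifs with hy
      · rw [div_self hK.ne', ENNReal.ofReal_one]
        exact prob_le_one
      · rw [measure_eq_zero_iff_ae_notMem.2]
        · exact zero_le
        · filter_upwards [h.start] with ω hω hω'
          exact hy (hω'.symm.trans hω)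
    rw [Finset.sum_range_succ']
    refine (add_le_add hstep hstart).trans_eq ?_
    rw [← ENNReal.ofReal_add, ← add_div, sub_add_cancel]
    · exact hsum.nonneg hnn
    · split_ifs <;> positivity

/-- A path that leaves every finite set eventually exceeds level `L`. Just before the first such
time it sits at level exactly `L`, since levels change by at most one. That time is at least `L`
because a path from the root has length at most `n` at time `n`. -/
theorem exists_upcrossing {z : ℕ → Word} (hz0 : z 0 = [])
    (hz : ∀ n, sgConductance lam C₁ C₂ (z n) (z (n + 1)) ≠ 0)
    (hesc : ∀ x, ∀ᶠ n in atTop, z n ≠ x) (L : ℕ) :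
    ∃ n, L ≤ n ∧ (z n).length = L ∧ ∃ i, z (n + 1) = z n ++ [i] := by
  classical
  have hlen (n : ℕ) : (z n).length ≤ n := by
    induction n with
    | zero => simp [hz0]
    | succ n ih =>
      rcases isFather_or_of_sgConductance_ne_zero (hz n) with h | h | h
      · have := h.length_eq; omega
      · have := h.length_eq; omega
      · omega
  have hex : ∃ m, L < (z m).length := by
    have hev : ∀ᶠ n in atTop, ∀ x ∈ (Finset.range (L + 1)).biUnion levelWords, z n ≠ x :=
      (Filter.eventually_all_finset _).2 fun x _ => hesc x
    obtain ⟨m, hm⟩ := hev.exists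
    refine ⟨m, not_le.1 fun hle => hm (z m) ?_ rfl⟩
    simp only [Finset.mem_biUnion, Finset.mem_range, mem_levelWords]
    exact ⟨_, Nat.lt_succ_iff.2 hle, rfl⟩
  obtain ⟨n, hn⟩ : ∃ n, Nat.find hex = n + 1 := by
    refine Nat.exists_eq_succ_of_ne_zero fun h => ?_
    have := Nat.find_spec hex
    rw [h, hz0] at this
    simp at this
  have hup : L < (z (n + 1)).length := hn ▸ Nat.find_spec hex
  have hlow : (z n).length ≤ L := not_lt.1 (Nat.find_min hex (by omega))
  rcases isFather_or_of_sgConductance_ne_zero (hz n) with h | h | h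
  · have := h.length_eq
    have := hlen n
    exact ⟨n, by omega, by omega, isFather_iff.1 h⟩
  · have := h.length_eq; omega
  · omega

/-- Transience comes from Borel–Cantelli: the expected number of visits to each vertex is finite. -/
theorem IsRandomWalk.ae_exists_upcrossing [IsProbabilityMeasure ℙ] (h0 : 0 < lam) (h1 : lam < 1)
    (hC₁ : 0 < C₁) (hC₂ : 0 < C₂) (h : IsRandomWalk (sgConductance lam C₁ C₂) [] ℙ Z) :
    ∀ᵐ ω ∂ℙ, ∀ L, ∃ n, L ≤ n ∧ (Z n ω).length = L ∧ ∃ i, Z (n + 1) ω = Z n ω ++ [i] := by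
  have hesc : ∀ᵐ ω ∂ℙ, ∀ x, ∀ᶠ n in atTop, ω ∉ Z n ⁻¹' {x} :=
    ae_all_iff.2 fun x => ae_eventually_notMem
      ((tsum_measure_visit_le h0 h1 hC₁ hC₂ h x).trans_lt ENNReal.ofReal_lt_top).ne
  filter_upwards [h.start, h.ae_conductance_ne_zero, hesc] with ω hω0 hω hωesc
  exact exists_upcrossing hω0 hω hωesc

theorem measurable_upcrossingSum {c : Word → Word → ℝ} (f : Word → ℝ)
    (h : IsRandomWalk c [] ℙ Z) (L : ℕ) : Measurable (upcrossingSum f Z L) :=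
  Finset.measurable_fun_sum _ fun _ _ => Finset.measurable_fun_sum _ fun _ _ =>
    Measurable.tsum fun _ => measurable_const.indicator
      ((h.measurable _ _).inter (h.measurable _ _))

/-- The expected number of crossings from `w` to a child is at most the visit bound times `P`. There
`π(w)` cancels, and `lam ^ L` times the conductance leaves `3⁻ᴸ / (3 (1 - lam))`; the three children
remove the last `3`. -/
theorem lintegral_upcrossingSum_le [IsProbabilityMeasure ℙ] (h0 : 0 < lam) (h1 : lam < 1)
    (hC₁ : 0 < C₁) (hC₂ : 0 < C₂) (h : IsRandomWalk (sgConductance lam C₁ C₂) [] ℙ Z)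
    (f : Word → ℝ) (L : ℕ) :
    ∫⁻ ω, upcrossingSum f Z L ω ∂ℙ ≤ ENNReal.ofReal (levelMeanSq f L / (1 - lam)) := by
  have hK : 0 < 1 - lam := sub_pos.2 h1
  have hm (w : Word) (i : Fin 3) (n : ℕ) :
      MeasurableSet (Z n ⁻¹' {w} ∩ Z (n + 1) ⁻¹' {w ++ [i]}) :=
    (h.measurable _ _).inter (h.measurable _ _)
  have hterm (w : Word) (hw : w ∈ levelWords L) (i : Fin 3) :
      ∫⁻ ω, ∑' n, (Z n ⁻¹' {w} ∩ Z (n + 1) ⁻¹' {w ++ [i]}).indicator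
        (fun _ => ENNReal.ofReal (f w ^ 2)) ω ∂ℙ ≤
      ENNReal.ofReal (f w ^ 2 / 3 ^ L / (3 * (1 - lam))) := by
    rw [lintegral_tsum fun n => (measurable_const.indicator (hm w i n)).aemeasurable]
    simp_rw [lintegral_indicator_const (hm w i _), h.measure_step]
    rw [ENNReal.tsum_mul_left, ENNReal.tsum_mul_right]
    have hπ := totalConductance_pos h0 hC₁ hC₂ w
    refine (mul_le_mul_right (mul_le_mul_left
      (tsum_measure_visit_le h0 h1 hC₁ hC₂ h w) _) _).trans_eq ?_
    rw [← ENNReal.ofReal_mul (by positivity), ← ENNReal.ofReal_mul (sq_nonneg _), transition,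
      sgConductance_append, mem_levelWords.1 hw, mul_pow]
    congr 1
    field_simp
  unfold upcrossingSum
  rw [lintegral_finsetSum _ fun w _ => Finset.measurable_fun_sum _ fun i _ =>
    Measurable.tsum fun n => measurable_const.indicator (hm w i n)]
  calc _ ≤ ∑ w ∈ levelWords L, ∑ _i : Fin 3,
        ENNReal.ofReal (f w ^ 2 / 3 ^ L / (3 * (1 - lam))) := by
        refine Finset.sum_le_sum fun w hw => ?_
        rw [lintegral_finsetSum _ fun i _ =>
          Measurable.tsum fun n => measurable_const.indicator (hm w i n)]
        exact Finset.sum_le_sum fun i _ => hterm w hw i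
    _ = ENNReal.ofReal (∑ w ∈ levelWords L, ∑ _i : Fin 3, f w ^ 2 / 3 ^ L / (3 * (1 - lam))) := by
        rw [ENNReal.ofReal_sum_of_nonneg fun w _ => by positivity]
        refine Finset.sum_congr rfl fun w _ => ?_
        rw [ENNReal.ofReal_sum_of_nonneg fun i _ => by positivity]
    _ = _ := by
        congr 1
        simp only [Finset.sum_const, Finset.card_univ, Fintype.card_fin, nsmul_eq_mul, levelMeanSq,
          Finset.sum_div]
        refine Finset.sum_congr rfl fun w _ => ?_
        field_simp
        exact mul_comm _ _

end RandomWalk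

/-! ### The gasket and its cells -/

theorem sgCorner_eq_sgMap (i : Fin 3) : sgMap i (sgCorner i) = sgCorner i := by
  rw [sgMap, ← two_smul ℝ, smul_smul]
  norm_num

theorem isClosedMap_sgMap (i : Fin 3) : IsClosedMap (sgMap i) :=
  ((Homeomorph.addRight (sgCorner i)).trans
    (Homeomorph.smulOfNeZero (1 / 2 : ℝ) (by norm_num))).isClosedMap

theorem lipschitzWith_sgMap (i : Fin 3) : LipschitzWith (1 / 2) (sgMap i) := by
  refine LipschitzWith.of_dist_le_mul fun x y => ?_
  rw [sgMap, sgMap, dist_smul₀, dist_add_right]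
  norm_num

theorem gasket_subset : gasket ⊆ ⋃ i, sgMap i '' gasket := by
  refine closure_minimal ?_ (isClosed_iUnion_of_finite fun i =>
    isClosedMap_sgMap i _ isClosed_closure)
  have hsub (n : ℕ) : sgVertices n ⊆ gasket :=
    (subset_iUnion sgVertices n).trans subset_closure
  refine iUnion_subset fun n => ?_
  cases n with
  | zero =>
    rintro _ ⟨i, rfl⟩
    exact mem_iUnion.2 ⟨i, sgCorner i, hsub 0 (mem_range_self i), sgCorner_eq_sgMap i⟩
  | succ n => exact iUnion_mono fun i => image_mono (hsub n)

theorem sgCell_cons (i : Fin 3) (w : Word) : sgCell (i :: w) = sgMap i '' sgCell w :=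
  image_comp (sgMap i) (wordMap w) gasket

theorem sgCell_nil : sgCell [] = gasket := image_id gasket

theorem isClosed_sgCell (w : Word) : IsClosed (sgCell w) := by
  induction w with
  | nil => rw [sgCell_nil]; exact isClosed_closure
  | cons i w ih => rw [sgCell_cons]; exact isClosedMap_sgMap i _ ih

theorem exists_mem_sgCell (n : ℕ) {ξ : Plane} (hξ : ξ ∈ gasket) :
    ∃ w : Word, w.length = n ∧ ξ ∈ sgCell w := by
  induction n generalizing ξ with
  | zero => exact ⟨[], rfl, sgCell_nil ▸ hξ⟩
  | succ n ih =>
    obtain ⟨i, η, hη, rfl⟩ := mem_iUnion.1 (gasket_subset hξ)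
    obtain ⟨w, hw, hηw⟩ := ih hη
    exact ⟨i :: w, by simp [hw], sgCell_cons i w ▸ mem_image_of_mem _ hηw⟩

/-- Containing `ξ` makes the distance zero, so the words need not be prefixes of one another. -/
theorem tendsto_approach {ξ : Plane} {w : ℕ → Word} (hlen : ∀ n, (w n).length = n)
    (hmem : ∀ n, ξ ∈ sgCell (w n)) : Tendsto w atTop (approach ξ) := by
  refine tendsto_inf.2 ⟨tendsto_comap_iff.2 ?_, tendsto_comap_iff.2 ?_⟩
  · exact tendsto_id.congr fun n => (hlen n).symm
  · exact tendsto_const_nhds.congr fun n => (Metric.infDist_zero_of_mem (hmem n)).symm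

theorem hausdorffMeasure_sgCell_le (w : Word) :
    Measure.hausdorffMeasure (Real.log 3 / Real.log 2) (sgCell w) ≤
      ENNReal.ofReal ((1 / 3) ^ w.length) *
        Measure.hausdorffMeasure (Real.log 3 / Real.log 2) gasket := by
  induction w with
  | nil => simp [sgCell_nil]
  | cons i w ih =>
    have hd : 0 ≤ Real.log 3 / Real.log 2 := by positivity
    -- The dimension is chosen so that halving lengths divides the measure by three.
    have hscale : (((1 / 2 : NNReal) : ENNReal)) ^ (Real.log 3 / Real.log 2) =
        ENNReal.ofReal (1 / 3) := by
      rw [← ENNReal.coe_rpow_of_nonneg _ hd, ENNReal.ofReal, ENNReal.coe_inj]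
      refine NNReal.coe_injective ?_
      rw [NNReal.coe_rpow, Real.coe_toNNReal _ (by norm_num)]
      have h2 : Real.log 2 ≠ 0 := (Real.log_pos one_lt_two).ne'
      rw [Real.rpow_def_of_pos (by norm_num)]
      simp only [one_div, NNReal.coe_inv, NNReal.coe_ofNat, Real.log_inv]
      rw [neg_mul, mul_div_cancel₀ _ h2, Real.exp_neg, Real.exp_log (by norm_num)]
    rw [sgCell_cons]
    refine ((lipschitzWith_sgMap i).hausdorffMeasure_image_le hd _).trans ?_
    rw [hscale, List.length_cons, pow_succ', ENNReal.ofReal_mul (by norm_num), mul_assoc]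
    exact mul_le_mul_right ih _

/-- The normalized Hausdorff measure on the gasket. -/
noncomputable def normalizedHausdorff : Measure Plane :=
  ProbabilityTheory.cond (Measure.hausdorffMeasure (Real.log 3 / Real.log 2)) gasket

/-- The inequality `a⁻¹ * a ≤ 1` also holds for `a = 0` and `a = ∞`, so it need not be known that
the gasket has positive finite measure. -/
theorem normalizedHausdorff_sgCell_le (w : Word) :
    normalizedHausdorff (sgCell w) ≤ ENNReal.ofReal ((1 / 3) ^ w.length) := by
  rw [normalizedHausdorff, ProbabilityTheory.cond, Measure.smul_apply, smul_eq_mul]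
  refine (mul_le_mul_right ((Measure.restrict_le_self _).trans
    (hausdorffMeasure_sgCell_le w)) _).trans ?_
  rw [mul_left_comm]
  exact mul_le_of_le_one_right' (ENNReal.inv_mul_le_one _)

theorem normalizedHausdorff_univ_le : normalizedHausdorff univ ≤ 1 := by
  rw [normalizedHausdorff, ProbabilityTheory.cond, Measure.smul_apply, smul_eq_mul,
    Measure.restrict_apply_univ]
  exact ENNReal.inv_mul_le_one _

/-- The sum of `f²` over the words of length `n` whose cell contains `ξ`. -/
noncomputable def cellSum (f : Word → ℝ) (n : ℕ) (ξ : Plane) : ENNReal :=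
  ∑ w ∈ levelWords n, (sgCell w).indicator (fun _ => ENNReal.ofReal (f w ^ 2)) ξ

theorem measurable_cellSum (f : Word → ℝ) (n : ℕ) : Measurable (cellSum f n) :=
  Finset.measurable_fun_sum _ fun w _ =>
    measurable_const.indicator (isClosed_sgCell w).measurableSet

theorem le_cellSum (f : Word → ℝ) {n : ℕ} {w : Word} {ξ : Plane} (hw : w.length = n)
    (hξ : ξ ∈ sgCell w) : ENNReal.ofReal (f w ^ 2) ≤ cellSum f n ξ := by
  refine le_trans ?_ (Finset.single_le_sum (fun _ _ => zero_le) (mem_levelWords.2 hw))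
  rw [indicator_of_mem hξ]

theorem lintegral_cellSum_le (f : Word → ℝ) (n : ℕ) :
    ∫⁻ ξ, cellSum f n ξ ∂normalizedHausdorff ≤ ENNReal.ofReal (levelMeanSq f n) := by
  unfold cellSum
  rw [lintegral_finsetSum _ fun w _ =>
    measurable_const.indicator (isClosed_sgCell w).measurableSet, levelMeanSq, Finset.sum_div,
    ENNReal.ofReal_sum_of_nonneg fun w _ => by positivity]
  refine Finset.sum_le_sum fun w hw => ?_
  rw [lintegral_indicator_const (isClosed_sgCell w).measurableSet]
  refine (mul_le_mul_right (normalizedHausdorff_sgCell_le w) _).trans_eq ?_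
  rw [← ENNReal.ofReal_mul (sq_nonneg _), mem_levelWords.1 hw]
  congr 1
  rw [one_div, inv_pow, div_eq_mul_inv]

/-! ### Fatou estimates on the Martin compactification -/

section Fatou

variable {V : Type} {c : V → V → ℝ} {o : V}

/-- The value of `u²` at a limit in the Martin compactification is at most its lower limit along
any sequence; the term at the root makes the bound independent of the existence of the limit. -/
theorem ofReal_sq_martinLimit_le {A : Type*} {l : Filter A} (g : A → V)
    (u : C(MartinCompactification c o, ℝ)) {k : ℕ → A} (hk : Tendsto k atTop l)
    {F : ℕ → ENNReal} (hF : ∀ n, ENNReal.ofReal (u (toMartin c o (g (k n))) ^ 2) ≤ F n) :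
    ENNReal.ofReal (u (martinLimit c o l g) ^ 2) ≤
      ENNReal.ofReal (u (toMartin c o o) ^ 2) + liminf F atTop := by
  unfold martinLimit
  split_ifs with h
  · have ht : Tendsto (fun n => ENNReal.ofReal (u (toMartin c o (g (k n))) ^ 2)) atTop
        (𝓝 (ENNReal.ofReal (u h.choose ^ 2))) :=
      (ENNReal.continuous_ofReal.tendsto _).comp
        (((u.continuous.tendsto _).comp (h.choose_spec.comp hk)).pow 2)
    rw [← ht.liminf_eq]
    exact (liminf_le_liminf (Eventually.of_forall hF)).trans le_add_self
  · exact le_self_add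

/-- Fatou's lemma for the majorants `F n`. No measurability of `Φ` is required, since integrals
against `μ.map Φ` are always bounded by integrals of the composition. -/
theorem lintegral_ofReal_sq_map_le {Ω : Type*} [MeasurableSpace Ω] {μ : Measure Ω}
    (hμ : μ univ ≤ 1) (u : C(MartinCompactification c o, ℝ))
    (Φ : Ω → MartinCompactification c o) {F : ℕ → Ω → ENNReal} (hF : ∀ n, Measurable (F n))
    {a b : ENNReal}
    (h : ∀ᵐ ω ∂μ, ENNReal.ofReal (u (Φ ω) ^ 2) ≤ a + liminf (fun n => F n ω) atTop)
    (hb : ∀ n, ∫⁻ ω, F n ω ∂μ ≤ b) :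
    ∫⁻ z, ENNReal.ofReal (u z ^ 2) ∂(μ.map Φ) ≤ a + b := by
  calc ∫⁻ z, ENNReal.ofReal (u z ^ 2) ∂(μ.map Φ)
      ≤ ∫⁻ ω, ENNReal.ofReal (u (Φ ω) ^ 2) ∂μ := lintegral_map_le _ _
    _ ≤ ∫⁻ ω, a + liminf (fun n => F n ω) atTop ∂μ := lintegral_mono_ae h
    _ = a * μ univ + ∫⁻ ω, liminf (fun n => F n ω) atTop ∂μ := by
        rw [lintegral_add_left measurable_const, lintegral_const]
    _ ≤ a + b := by
        refine add_le_add (mul_le_of_le_one_right' hμ) ((lintegral_liminf_le hF).trans ?_)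
        exact liminf_le_of_frequently_le' (Frequently.of_forall hb)

theorem measure_map_univ_le {Ω : Type*} [MeasurableSpace Ω] {μ : Measure Ω}
    (hμ : μ univ ≤ 1) (Φ : Ω → MartinCompactification c o) : μ.map Φ univ ≤ 1 := by
  by_cases hΦ : AEMeasurable Φ μ
  · rwa [Measure.map_apply_of_aemeasurable hΦ .univ]
  · simp [Measure.map_of_not_aemeasurable hΦ]

/-- A bound for the second moment gives the two bounds by the square root of the form. -/
theorem integrable_and_le_of_lintegral_sq_le {X : Type*} [TopologicalSpace X] [MeasurableSpace X]
    [BorelSpace X] {ν : Measure X} (hν : ν univ ≤ 1) (u : C(X, ℝ)) {D E : ℝ} (hD : 0 ≤ D)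
    (hE : 0 ≤ E) (h : ∫⁻ z, ENNReal.ofReal (u z ^ 2) ∂ν ≤ ENNReal.ofReal (D * E)) :
    Integrable (fun z => |u z| ^ 2) ν ∧ √(∫ z, |u z| ^ 2 ∂ν) ≤ √D * √E ∧
      Integrable (fun z => |u z|) ν ∧ ∫ z, |u z| ∂ν ≤ √D * √E := by
  have : IsFiniteMeasure ν := ⟨hν.trans_lt ENNReal.one_lt_top⟩
  have hmeas : Measurable u := u.continuous.measurable
  have hsq : Integrable (fun z => u z ^ 2) ν := by
    refine ⟨(hmeas.pow_const 2).aestronglyMeasurable, ?_⟩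
    rw [hasFiniteIntegral_iff_ofReal (Eventually.of_forall fun z => sq_nonneg _)]
    exact h.trans_lt ENNReal.ofReal_lt_top
  have habs : Integrable (fun z => |u z|) ν := by
    refine ((integrable_const (1 : ℝ)).add hsq).mono' hmeas.abs.aestronglyMeasurable
      (Eventually.of_forall fun z => ?_)
    rw [Real.norm_eq_abs, abs_abs, Pi.add_apply, ← sq_abs]
    nlinarith [sq_nonneg (|u z| - 1)]
  have hle : ∫ z, u z ^ 2 ∂ν ≤ D * E := by
    rw [integral_eq_lintegral_of_nonneg_ae (Eventually.of_forall fun z => sq_nonneg _)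
      hsq.aestronglyMeasurable]
    exact ENNReal.toReal_le_of_le_ofReal (by positivity) h
  have hmean : (∫ z, |u z| ∂ν) ^ 2 ≤ ∫ z, u z ^ 2 ∂ν := by
    -- Integrating `(t - |u|)² ≥ 0` gives `2t² ≤ t² ν(X) + ∫ u²`, which suffices for a measure of
    -- mass at most one.
    set t := ∫ z, |u z| ∂ν with ht
    have hmono : ∫ z, 2 * t * |u z| ∂ν ≤ ∫ z, t ^ 2 + u z ^ 2 ∂ν := by
      refine integral_mono (habs.const_mul _) ((integrable_const _).add hsq) fun z => ?_
      simp only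
      rw [← sq_abs (u z)]
      nlinarith [sq_nonneg (t - |u z|)]
    rw [integral_const_mul, ← ht, integral_add (integrable_const _) hsq, integral_const,
      smul_eq_mul] at hmono
    have h1 : ν.real univ ≤ 1 := ENNReal.toReal_le_of_le_ofReal zero_le_one (by simpa using hν)
    nlinarith [mul_le_mul_of_nonneg_right h1 (sq_nonneg t)]
  simp only [sq_abs]
  rw [← Real.sqrt_mul hD]
  exact ⟨hsq, Real.sqrt_le_sqrt hle, habs, Real.le_sqrt_of_sq_le (hmean.trans hle)⟩

end Fatou

/-! ### The form -/

section Form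

variable {lam C₁ C₂ c : ℝ} {u : C(MartinCompactification (sgConductance lam C₁ C₂) [], ℝ)}

theorem formEnergy_nonneg (h0 : 0 < lam) (hC₁ : 0 < C₁) (hC₂ : 0 < C₂) :
    0 ≤ formEnergy (sgConductance lam C₁ C₂) [] u :=
  mul_nonneg (by norm_num) (tsum_nonneg fun p =>
    mul_nonneg (sgConductance_nonneg h0 hC₁ hC₂ _ _) (sq_nonneg _))

/-- Each vertical edge is matched with the ordered pair (father, child). The reversed pairs and the
horizontal edges are dropped; the factor `2` undoes the `1/2` in the energy. -/
theorem sum_verticalEnergy_le (h0 : 0 < lam) (hC₁ : 0 < C₁) (hC₂ : 0 < C₂)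
    (hu : u ∈ formDomain (sgConductance lam C₁ C₂) []) (n : ℕ) :
    ∑ k ∈ Finset.range n, verticalEnergy lam (fun w => u (toMartin _ [] w)) k ≤
      2 * formEnergy (sgConductance lam C₁ C₂) [] u := by
  classical
  set f : Word → ℝ := fun w => u (toMartin (sgConductance lam C₁ C₂) [] w) with hf
  let T : Word × Word → ℝ := fun p => sgConductance lam C₁ C₂ p.1 p.2 * (f p.1 - f p.2) ^ 2
  let φ : Word × Fin 3 → Word × Word := fun q => (q.1, q.1 ++ [q.2])
  have hT0 (p) : 0 ≤ T p := mul_nonneg (sgConductance_nonneg h0 hC₁ hC₂ _ _) (sq_nonneg _)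
  have hT : Summable T := hu
  have hφ : Function.Injective φ := by
    rintro ⟨w, i⟩ ⟨w', i'⟩ h
    simp only [φ, Prod.mk.injEq] at h
    obtain ⟨rfl, h⟩ := h
    simpa using h
  have hdisj : (↑(Finset.range n) : Set ℕ).PairwiseDisjoint levelWords := by
    intro k _ k' _ hk
    refine Finset.disjoint_left.2 fun w hw hw' => hk ?_
    rw [← mem_levelWords.1 hw, mem_levelWords.1 hw']
  calc ∑ k ∈ Finset.range n, verticalEnergy lam f k
      = ∑ q ∈ ((Finset.range n).biUnion levelWords) ×ˢ Finset.univ, T (φ q) := by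
        rw [Finset.sum_product, Finset.sum_biUnion hdisj]
        refine Finset.sum_congr rfl fun k _ => ?_
        rw [verticalEnergy, Finset.sum_div]
        refine Finset.sum_congr rfl fun w hw => ?_
        rw [Finset.sum_div]
        refine Finset.sum_congr rfl fun i _ => ?_
        simp only [T, φ]
        rw [sgConductance_append, mem_levelWords.1 hw]
        ring
    _ ≤ ∑' q, T (φ q) := (hT.comp_injective hφ).sum_le_tsum _ fun q _ => hT0 _
    _ ≤ ∑' p, T p := _root_.tsum_comp_le_tsum_of_inj hT hT0 hφ
    _ = 2 * formEnergy (sgConductance lam C₁ C₂) [] u := by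
        rw [formEnergy]; ring

theorem levelMeanSq_le_formEnergy (h0 : 0 < lam) (h1 : lam < 1) (hC₁ : 0 < C₁) (hC₂ : 0 < C₂)
    (hu : u ∈ formDomain (sgConductance lam C₁ C₂) []) (n : ℕ) :
    levelMeanSq (fun w => u (toMartin _ [] w)) n ≤ (1 + (1 - lam)⁻¹) *
      (u (toMartin _ [] []) ^ 2 + 2 * formEnergy (sgConductance lam C₁ C₂) [] u) :=
  levelMeanSq_le h0 h1 (sum_verticalEnergy_le h0 hC₁ hC₂ hu) n

theorem lintegral_vertexMeasure {V : Type} {c : V → V → ℝ} {o : V} (m : V → ℝ)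
    (u : C(MartinCompactification c o, ℝ)) :
    ∫⁻ z, ENNReal.ofReal (u z ^ 2) ∂(vertexMeasure c o m) =
      ∑' x, ENNReal.ofReal (m x) * ENNReal.ofReal (u (toMartin c o x) ^ 2) := by
  have hmeas : Measurable fun z => ENNReal.ofReal (u z ^ 2) :=
    (u.continuous.measurable.pow_const 2).ennreal_ofReal
  rw [vertexMeasure, lintegral_sum_measure]
  refine tsum_congr fun x => ?_
  rw [lintegral_smul_measure, lintegral_dirac' _ hmeas, smul_eq_mul]

/-- Level `n` contributes `(c / lam) ^ n` times its mean square, and the means are bounded, so `c <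
lam` gives a geometric majorant. Without integrability the Bochner integral in `formEnergyOne` would
be `0` and could not control the root value. -/
theorem integrable_sq_vertexMeasure (h0 : 0 < lam) (h1 : lam < 1) (hC₁ : 0 < C₁) (hC₂ : 0 < C₂)
    (hc0 : 0 < c) (hc : c < lam) (hu : u ∈ formDomain (sgConductance lam C₁ C₂) []) :
    Integrable (fun z => u z ^ 2) (vertexMeasure _ [] (sgWeight lam c)) := by
  refine ⟨(u.continuous.measurable.pow_const 2).aestronglyMeasurable, ?_⟩
  rw [hasFiniteIntegral_iff_ofReal (Eventually.of_forall fun z => sq_nonneg _),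
    lintegral_vertexMeasure, tsum_eq_tsum_levelWords]
  set B := (1 + (1 - lam)⁻¹) *
      (u (toMartin _ [] []) ^ 2 + 2 * formEnergy (sgConductance lam C₁ C₂) [] u)
  have hs : Summable fun n : ℕ => (c / lam) ^ n * B :=
    (summable_geometric_of_lt_one (by positivity) ((div_lt_one h0).2 hc)).mul_right B
  refine lt_of_le_of_lt (ENNReal.tsum_le_tsum fun n => ?_) hs.tsum_ofReal_lt_top
  have hmean := levelMeanSq_le_formEnergy h0 h1 hC₁ hC₂ hu n
  simp_rw [← ENNReal.ofReal_mul (show 0 ≤ sgWeight lam c _ by unfold sgWeight; positivity)]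
  rw [← ENNReal.ofReal_sum_of_nonneg fun w _ => by unfold sgWeight; positivity]
  refine ENNReal.ofReal_le_ofReal (le_trans (le_of_eq ?_)
    (mul_le_mul_of_nonneg_left hmean (by positivity)))
  rw [levelMeanSq, Finset.sum_div, Finset.mul_sum]
  refine Finset.sum_congr rfl fun w hw => ?_
  rw [sgWeight, mem_levelWords.1 hw, div_pow, div_pow, mul_pow]
  field_simp

theorem sq_root_le_integral (h0 : 0 < lam) (h1 : lam < 1) (hC₁ : 0 < C₁) (hC₂ : 0 < C₂)
    (hc0 : 0 < c) (hc : c < lam) (hu : u ∈ formDomain (sgConductance lam C₁ C₂) []) :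
    u (toMartin _ [] []) ^ 2 ≤ ∫ z, u z ^ 2 ∂(vertexMeasure _ [] (sgWeight lam c)) := by
  have hint := integrable_sq_vertexMeasure h0 h1 hC₁ hC₂ hc0 hc hu
  rw [← ENNReal.ofReal_le_ofReal_iff (integral_nonneg fun z => sq_nonneg _),
    ofReal_integral_eq_lintegral_ofReal hint (Eventually.of_forall fun z => sq_nonneg _),
    lintegral_vertexMeasure]
  refine le_trans (le_of_eq ?_) (ENNReal.le_tsum [])
  simp [sgWeight]

theorem sq_root_le_formEnergyOne (h0 : 0 < lam) (h1 : lam < 1) (hC₁ : 0 < C₁) (hC₂ : 0 < C₂)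
    (hc0 : 0 < c) (hc : c < lam) (hu : u ∈ formDomain (sgConductance lam C₁ C₂) []) :
    u (toMartin _ [] []) ^ 2 ≤
      formEnergyOne (sgConductance lam C₁ C₂) [] (sgWeight lam c) u := by
  have := sq_root_le_integral h0 h1 hC₁ hC₂ hc0 hc hu
  have := formEnergy_nonneg (u := u) h0 hC₁ hC₂
  rw [formEnergyOne]
  linarith

theorem levelMeanSq_le_formEnergyOne (h0 : 0 < lam) (h1 : lam < 1) (hC₁ : 0 < C₁)
    (hC₂ : 0 < C₂) (hc0 : 0 < c) (hc : c < lam)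
    (hu : u ∈ formDomain (sgConductance lam C₁ C₂) []) (n : ℕ) :
    levelMeanSq (fun w => u (toMartin _ [] w)) n ≤ 2 * (1 + (1 - lam)⁻¹) *
      formEnergyOne (sgConductance lam C₁ C₂) [] (sgWeight lam c) u := by
  have := sub_pos.2 h1
  have hroot := sq_root_le_integral h0 h1 hC₁ hC₂ hc0 hc hu
  refine (levelMeanSq_le_formEnergy h0 h1 hC₁ hC₂ hu n).trans ?_
  rw [mul_comm 2 (1 + (1 - lam)⁻¹), mul_assoc]
  refine mul_le_mul_of_nonneg_left ?_ (by positivity)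
  rw [formEnergyOne]
  linarith [sq_nonneg (u (toMartin (sgConductance lam C₁ C₂) [] []))]

theorem lintegral_sq_gasketMeasure_le
    (u : C(MartinCompactification (sgConductance lam C₁ C₂) [], ℝ))
    {B : ℝ} (hB : ∀ n, levelMeanSq (fun w => u (toMartin _ [] w)) n ≤ B) :
    ∫⁻ z, ENNReal.ofReal (u z ^ 2) ∂(gasketMeasure (sgConductance lam C₁ C₂)) ≤
      ENNReal.ofReal (u (toMartin _ [] []) ^ 2) + ENNReal.ofReal B := by
  refine lintegral_ofReal_sq_map_le (μ := normalizedHausdorff) normalizedHausdorff_univ_le u _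
    (measurable_cellSum fun w => u (toMartin _ [] w)) ?_
    fun n => (lintegral_cellSum_le _ n).trans (ENNReal.ofReal_le_ofReal (hB n))
  have hmem : ∀ᵐ ξ ∂normalizedHausdorff, ξ ∈ gasket :=
    ProbabilityTheory.ae_cond_mem isClosed_closure.measurableSet
  filter_upwards [hmem] with ξ hξ
  choose w hlen hcell using fun n => exists_mem_sgCell n hξ
  exact ofReal_sq_martinLimit_le id u (tendsto_approach hlen hcell) fun n =>
    le_cellSum (fun w => u (toMartin _ [] w)) (hlen n) (hcell n)

theorem lintegral_sq_hittingDistribution_le {Ω : Type*} [MeasurableSpace Ω] {ℙ : Measure Ω}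
    [IsProbabilityMeasure ℙ] {Z : ℕ → Ω → Word} (h0 : 0 < lam) (h1 : lam < 1) (hC₁ : 0 < C₁)
    (hC₂ : 0 < C₂) (h : IsRandomWalk (sgConductance lam C₁ C₂) [] ℙ Z)
    (u : C(MartinCompactification (sgConductance lam C₁ C₂) [], ℝ))
    {B : ℝ} (hB : ∀ n, levelMeanSq (fun w => u (toMartin _ [] w)) n ≤ B) :
    ∫⁻ z, ENNReal.ofReal (u z ^ 2) ∂(hittingDistribution (sgConductance lam C₁ C₂) [] ℙ Z) ≤
      ENNReal.ofReal (u (toMartin _ [] []) ^ 2) + ENNReal.ofReal (B / (1 - lam)) := by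
  have := sub_pos.2 h1
  refine lintegral_ofReal_sq_map_le prob_le_one u _
    (measurable_upcrossingSum (fun w => u (toMartin _ [] w)) h) ?_
    fun n => (lintegral_upcrossingSum_le h0 h1 hC₁ hC₂ h _ n).trans
      (ENNReal.ofReal_le_ofReal (by gcongr; exact hB n))
  filter_upwards [h.ae_exists_upcrossing h0 h1 hC₁ hC₂] with ω hω
  choose k hk hlen i hi using hω
  exact ofReal_sq_martinLimit_le (fun n => Z n ω) u
    (tendsto_atTop_mono hk tendsto_id) fun L =>
      le_upcrossingSum (fun w => u (toMartin _ [] w)) (hlen L) (hi L)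

end Form

theorem mainTheorem6 (lam C₁ C₂ c : ℝ) (hlam : lam ∈ Set.Ioo (0 : ℝ) 1)
    (hC₁ : 0 < C₁) (hC₂ : 0 < C₂) (hc : c ∈ Set.Ioo (0 : ℝ) lam) :
    ∃ C : ℝ, 0 < C ∧
      ∀ (Ω : Type*) [MeasurableSpace Ω] (ℙ : Measure Ω) [IsProbabilityMeasure ℙ]
        (Z : ℕ → Ω → Word), IsRandomWalk (sgConductance lam C₁ C₂) [] ℙ Z →
      ∀ ν : Measure (MartinCompactification (sgConductance lam C₁ C₂) []),
        (ν = hittingDistribution (sgConductance lam C₁ C₂) [] ℙ Z ∨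
          ν = gasketMeasure (sgConductance lam C₁ C₂)) →
      ∀ u ∈ formDomain (sgConductance lam C₁ C₂) [],
        Integrable (fun z => |u z| ^ 2) ν ∧
        √(∫ z, |u z| ^ 2 ∂ν) ≤
          C * √(formEnergyOne (sgConductance lam C₁ C₂) [] (sgWeight lam c) u) ∧
        Integrable (fun z => |u z|) ν ∧
        ∫ z, |u z| ∂ν ≤
          C * √(formEnergyOne (sgConductance lam C₁ C₂) [] (sgWeight lam c) u) := by
  obtain ⟨h0, h1⟩ := hlam
  obtain ⟨hc0, hc⟩ := hc
  have hpos := sub_pos.2 h1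
  set A := 2 * (1 + (1 - lam)⁻¹) with hA
  have hA0 : 0 < A := by positivity
  -- The hitting bound loses a further `1 / (1 - lam)`; the larger constant serves both
  -- descriptions, and the summand `1` below pays for the root term.
  have hAA : A ≤ A / (1 - lam) := le_div_self hA0.le hpos (by linarith)
  have hD : 0 < 1 + A / (1 - lam) := by positivity
  refine ⟨√(1 + A / (1 - lam)), Real.sqrt_pos.2 hD, ?_⟩
  intro Ω _ ℙ _ Z hZ ν hν u hu
  have hroot := sq_root_le_formEnergyOne h0 h1 hC₁ hC₂ hc0 hc hu
  have hB := levelMeanSq_le_formEnergyOne h0 h1 hC₁ hC₂ hc0 hc hu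
  set E := formEnergyOne (sgConductance lam C₁ C₂) [] (sgWeight lam c) u
  have hE : 0 ≤ E := (sq_nonneg _).trans hroot
  -- Only mass at most one is needed; this includes the zero measure that `Measure.map` returns for
  -- a map that is not a.e. measurable.
  have hν1 : ν univ ≤ 1 := by
    rcases hν with rfl | rfl
    · exact measure_map_univ_le prob_le_one _
    · exact measure_map_univ_le normalizedHausdorff_univ_le _
  refine integrable_and_le_of_lintegral_sq_le hν1 u hD.le hE ?_
  have hsum : ENNReal.ofReal (u (toMartin _ [] []) ^ 2) + ENNReal.ofReal (A * E / (1 - lam)) ≤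
      ENNReal.ofReal ((1 + A / (1 - lam)) * E) := by
    rw [← ENNReal.ofReal_add (sq_nonneg _) (by positivity)]
    refine ENNReal.ofReal_le_ofReal ?_
    rw [add_mul, one_mul, div_mul_eq_mul_div]
    gcongr
  refine le_trans ?_ hsum
  rcases hν with rfl | rfl
  · exact lintegral_sq_hittingDistribution_le h0 h1 hC₁ hC₂ hZ u hB
  · refine (lintegral_sq_gasketMeasure_le u hB).trans ?_
    gcongr
    rw [mul_div_right_comm]
    gcongr
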